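/- A \emph{non-associative algebra} is an algebra $\mathcal A=(A,0,1,+,-,1',\breve{\ },;)$ such that $(A,0,1,+,-)$ is a Boolean algebra and, for all $x,y,z\in A$: $1';x=x=x;1'$, $\breve{\breve{x}}=x$, $(x;y)\breve{\ }=\breve y;\breve x$, $\breve 0=x;0=0$, $(x+y)\breve{\ }=\breve x+\breve y$, $x;(y+z)=x;y+x;z$, and $(x;y)\cdot\breve z=0$ if and only if $(y;z)\cdot\breve x=0$. A \emph{herd} over a set $D$ is a Boolean set algebra of binary relations on $D$ with top element $D\times D$ that contains the identity relation $\mathrm{Id}_D$ and is closed under relational converse. A \emph{qualitative representation} of $\mathcal A$ over $D$ is an injection $\phi$ from $A$ into a herd over $D$ such that, for all $a,b,c\in A$, $0^\phi=\varnothing$, $1^\phi=D\times D$, $(1')^\phi=\mathrm{Id}_D$, $(a+b)^\phi=a^\phi\cup b^\phi$, $(-a)^\phi=(D\times D)\setminus a^\phi$, $(\breve a)^\phi=\{(y,x):(x,y)\in a^\phi\}$, and $c^\phi\supseteq a^\phi\circ b^\phi\iff c\ge a;b$. A \emph{network} over $\mathcal A$ is a pair $(N,\lambda)$ with $N$ a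 finite set and $\lambda:N\times N\to A$ any function. It is \emph{qualitatively satisfiable} if there are a qualitative representation $\phi$ of $\mathcal A$ over some base $D$ and a map $x\mapsto x'$ from $N$ to $D$ such that $(x',y')\in\lambda(x,y)^\phi$ for all $x,y\in N$. \textbf{Theorem.} Let $\mathcal A$ be a fixed finite non-associative algebra. The network qualitative satisfaction problem over $\mathcal A$ (given a network $(N,\lambda)$ over $\mathcal A$, written as its matrix of labels, decide whether it is qualitatively satisfiable) is in $\mathbf{NP}$: there is a nondeterministic Turing machine that accepts exactly the encodings of the qualitatively satisfiable networks over $\mathcal A$, each of them by a computation whose length is bounded by a polynomial in the length of the encoding. -/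

import Mathlib

universe u

/-! ### Non-associative algebras -/

/-- A non-associative (relation) algebra `(A, 0, 1, +, -, 1', ˘, ;)`: the Boolean operations
`0, 1, +, ·, -` are `⊥, ⊤, ⊔, ⊓, ᶜ`. -/
class NonassocRelAlgebra (A : Type u) extends BooleanAlgebra A where
  /-- the identity constant `1'` -/
  ident : A
  /-- the converse operation -/
  conv : A → A
  /-- the composition operation `x ; y` -/
  comp : A → A → A
  ident_comp : ∀ x, comp ident x = x
  comp_ident : ∀ x, comp x ident = x
  conv_conv : ∀ x, conv (conv x) = x
  conv_comp : ∀ x y, conv (comp x y) = comp (conv y) (conv x)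
  conv_bot : conv ⊥ = ⊥
  comp_bot : ∀ x, comp x ⊥ = ⊥
  conv_sup : ∀ x y, conv (x ⊔ y) = conv x ⊔ conv y
  comp_sup : ∀ x y z, comp x (y ⊔ z) = comp x y ⊔ comp x z
  peirce : ∀ x y z, comp x y ⊓ conv z = ⊥ ↔ comp y z ⊓ conv x = ⊥

/-! ### Herds and qualitative representations -/

/-- A herd over the base `D`: a Boolean set algebra of binary relations with top element `D × D`,
containing the identity relation and closed under relational converse. -/
structure IsHerd {D : Type u} (S : Set (SetRel D D)) : Prop where
  univ_mem : Set.univ ∈ S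
  inter_mem : ∀ R ∈ S, ∀ T ∈ S, R ∩ T ∈ S
  compl_mem : ∀ R ∈ S, Rᶜ ∈ S
  id_mem : SetRel.id ∈ S
  inv_mem : ∀ R ∈ S, SetRel.inv R ∈ S

open NonassocRelAlgebra in
/-- `φ` is a qualitative representation of the algebra `A` over the base `D`: an injection of `A`
into a herd over `D` which respects the Boolean operations, the identity and converse, and for
which `a ; b` is the weak composition of `a` and `b`. -/
structure IsQualitativeRep {A : Type u} [NonassocRelAlgebra A] {D : Type u}
    (φ : A → SetRel D D) : Prop where
  exists_herd : ∃ S : Set (SetRel D D), IsHerd S ∧ ∀ a, φ a ∈ S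
  injective : Function.Injective φ
  map_bot : φ ⊥ = ∅
  map_top : φ ⊤ = Set.univ
  map_ident : φ ident = SetRel.id
  map_sup : ∀ a b, φ (a ⊔ b) = φ a ∪ φ b
  map_compl : ∀ a, φ aᶜ = (φ a)ᶜ
  map_conv : ∀ a, φ (conv a) = SetRel.inv (φ a)
  comp_subset_iff : ∀ a b c, SetRel.comp (φ a) (φ b) ⊆ φ c ↔ comp a b ≤ c

/-! ### Networks -/

/-- A network over `A` with node set `N`: every ordered pair of nodes is labelled by an element
of `A`. (No consistency is required.) -/
abbrev Network (N : Type) (A : Type u) : Type u := N → N → A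

/-- The network `lab` embeds into the (qualitative) representation `φ`. -/
def Network.EmbedsInto {N : Type} {A D : Type u} (lab : Network N A) (φ : A → SetRel D D) : Prop :=
  ∃ f : N → D, ∀ x y, (f x, f y) ∈ φ (lab x y)

/-- A network is qualitatively satisfiable if it embeds into some qualitative representation
of the algebra. -/
def Network.QualitativelySatisfiable {N : Type} {A : Type u} [NonassocRelAlgebra A]
    (lab : Network N A) : Prop :=
  ∃ (D : Type u) (φ : A → SetRel D D), IsQualitativeRep φ ∧ lab.EmbedsInto φ

/-- The encoding of a network with nodes `0, …, n - 1` as a word: the label matrix is written row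
by row, each row followed by the separator `none`; the labels are letters, since `A` is fixed. -/
def Network.encode {A : Type u} {n : ℕ} (lab : Network (Fin n) A) : List (Option A) :=
  (List.ofFn fun x : Fin n => (List.ofFn fun y : Fin n => some (lab x y)) ++ [none]).flatten

/-- The network qualitative satisfaction problem over `A`, as a language: the set of all encodings
of qualitatively satisfiable (finite) networks over `A`. -/
def networkQualSatProblem (A : Type u) [NonassocRelAlgebra A] : Language (Option A) :=
  {w | ∃ (n : ℕ) (lab : Network (Fin n) A), lab.QualitativelySatisfiable ∧ lab.encode = w}

/-! ### Nondeterministic Turing machines and the class NP -/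

/-- Head movements of a Turing machine. -/
inductive HeadMove : Type
  | left
  | stay
  | right

/-- The displacement of the head. -/
def HeadMove.toInt : HeadMove → ℤ
  | left => -1
  | stay => 0
  | right => 1

/-- A nondeterministic Turing machine with finitely many two-way infinite tapes, finitely many
states and finitely many tape symbols, and with input alphabet `α`. Tape `0` carries the input. -/
structure NTM (α : Type u) where
  /-- there are `workTapes + 1` tapes -/
  workTapes : ℕ
  State : Type u
  Symbol : Type u
  finite_state : Finite State
  finite_symbol : Finite Symbol
  blank : Symbol
  /-- input letters are tape symbols -/
  letter : α ↪ Symbol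
  letter_ne_blank : ∀ a, letter a ≠ blank
  start : State
  accept : State
  /-- `trans q s q' s' m`: in state `q`, with symbols `s` under the heads, the machine may write
  `s'`, move the heads by `m` and enter state `q'` -/
  trans : State → (Fin (workTapes + 1) → Symbol) →
    State → (Fin (workTapes + 1) → Symbol) → (Fin (workTapes + 1) → HeadMove) → Prop

namespace NTM

variable {α : Type u}

/-- A configuration: the state, the head positions and the tape contents. -/
@[ext]
structure Config (M : NTM α) where
  state : M.State
  head : Fin (M.workTapes + 1) → ℤ
  tape : Fin (M.workTapes + 1) → ℤ → M.Symbol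

/-- The initial configuration on the input word `w`: all heads are in cell `0`, the word is written
on tape `0` in the cells `0, …, |w| - 1`, and all other cells are blank. -/
def init (M : NTM α) (w : List α) : M.Config where
  state := M.start
  head := fun _ => 0
  tape := fun i z =>
    if i = 0 ∧ 0 ≤ z then (w[z.toNat]?).elim M.blank M.letter else M.blank

/-- One computation step from `c` to `c'`. -/
def Step (M : NTM α) (c c' : M.Config) : Prop :=
  ∃ (q : M.State) (s : Fin (M.workTapes + 1) → M.Symbol) (m : Fin (M.workTapes + 1) → HeadMove),
    M.trans c.state (fun i => c.tape i (c.head i)) q s m ∧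
      c' = { state := q
             head := fun i => c.head i + (m i).toInt
             tape := fun i => Function.update (c.tape i) (c.head i) (s i) }

/-- `M.Run t c c'`: some computation of exactly `t` steps leads from `c` to `c'`. -/
inductive Run (M : NTM α) : ℕ → M.Config → M.Config → Prop
  | refl (c : M.Config) : Run M 0 c c
  | head {t : ℕ} {c d e : M.Config} : M.Step c d → Run M t d e → Run M (t + 1) c e

/-- Some computation of at most `t` steps on input `w` reaches the accepting state. -/
def AcceptsWithin (M : NTM α) (w : List α) (t : ℕ) : Prop :=
  ∃ s ≤ t, ∃ c : M.Config, M.Run s (M.init w) c ∧ c.state = M.accept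

/-- Some computation on input `w` reaches the accepting state. -/
def Accepts (M : NTM α) (w : List α) : Prop :=
  ∃ t, M.AcceptsWithin w t

end NTM

/-- The language `L` is in NP: some nondeterministic Turing machine accepts exactly the words
of `L`, and accepts each of them by a computation whose length is at most a polynomial in the
length of the word. -/
def InNP {α : Type u} (L : Language α) : Prop :=
  ∃ (M : NTM α) (p : Polynomial ℕ), ∀ w : List α,
    (M.Accepts w ↔ w ∈ L) ∧ (w ∈ L → M.AcceptsWithin w (p.eval w.length))

/-!
The labels of a network can be checked against a finite structure. If a network embeds into a
qualitative representation `φ` over `D`, restrict `φ` to the images of the nodes together with three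
points for each triple `(a, b, c)` with `¬ a ; b ≤ c`, chosen so that they witness this failure.
The restriction is again a qualitative representation, since all conditions but the failures of
`a ; b ≤ c` are universal, and it has a bounded number of points beyond the nodes. Such a
restriction is described by the sets `δ p q` of algebra elements that hold at the pairs `(p, q)` of
its points. Conversely, a labelling `δ` whose triples are all consistent, with `1'` reflexive and
with the witnesses, gives a qualitative representation on the points modulo the equivalence
relation `1' ∈ δ p q` (`Consistent.exists_isQualitativeRep`).

To satisfy a network, guess for every pair of nodes the labelling of these two nodes and the
witnesses. The guesses fit together to one labelling of all points if, for all nodes `x, y, z`, the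
guesses for `(x, y)`, `(y, z)`, `(x, z)` extend to one consistent labelling of these three nodes and
the witnesses (`Network.qualitativelySatisfiable_of_labelling`). A condition on triples cannot refer
to the diagonal, so the reflexivity of `1'` is obtained from a weaker condition: every row of the
matrix of guesses has an entry with `1'`. If `1'` holds at `(x, y)`, consistency of the triple
`(x, x, y)` puts it at `(x, x)`.

It remains to check such a condition on all triples in polynomial time
(`inNP_exists_triples`). A deterministic automaton with three two-way heads on the annotated matrix
does this: while one head is on the entry `(x, y)`, the others move in lockstep along the rows `y`
and `x` (`matrixChecker`). A multi-tape Turing machine guesses the annotations onto all its tapes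
and simulates the automaton with one tape per head
(`MultiheadAutomaton.inNP_map_language`). The bound on the time needs no analysis of the automaton:
an accepting computation of minimal length repeats no configuration, and the number of
configurations is polynomial in the length of the word (`MultiheadAutomaton.exists_acceptsIn_le`).
-/

/-! ### Multihead automata -/

/-- What a head of a multihead automaton may read: a letter or one of the two end markers. -/
inductive Cell (Γ : Type u) : Type u
  | leftEnd
  | rightEnd
  | letter (g : Γ)

/-- The cell in position `p` of the word `v` between its end markers: position `0` holds the left
end marker, the positions `1, …, |v|` hold the letters, and all others the right end marker. -/
def cellAt {Γ : Type u} (v : List Γ) : ℕ → Cell Γ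
  | 0 => Cell.leftEnd
  | p + 1 => (v[p]?).elim Cell.rightEnd Cell.letter

/-- The effect of a head movement on a position in a word of length `n`. Heads cannot leave the
positions `0, …, n + 1`; on the left this is the truncation of the subtraction. -/
def HeadMove.apply (n : ℕ) : HeadMove → ℕ → ℕ
  | HeadMove.left, p => p - 1
  | HeadMove.stay, p => p
  | HeadMove.right, p => min (p + 1) (n + 1)

/-- A deterministic automaton with `k + 1` two-way heads, which all read the same word between end
markers; `next` is `none` where the automaton is stuck. -/
structure MultiheadAutomaton (Γ : Type u) (k : ℕ) where
  State : Type u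
  finite_state : Finite State
  start : State
  accept : State
  next : State → (Fin (k + 1) → Cell Γ) → Option (State × (Fin (k + 1) → HeadMove))

namespace MultiheadAutomaton

variable {Γ : Type u} {k : ℕ}

/-- A configuration on a given word: the state and the positions of the heads. -/
abbrev Config (M : MultiheadAutomaton Γ k) : Type u := M.State × (Fin (k + 1) → ℕ)

/-- All heads start on the first letter. -/
def initial (M : MultiheadAutomaton Γ k) : M.Config := (M.start, fun _ => 1)

/-- The successor of a configuration on the word `v`, if there is one. -/
def step (M : MultiheadAutomaton Γ k) (v : List Γ) (c : M.Config) : Option M.Config :=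
  (M.next c.1 fun i => cellAt v (c.2 i)).map fun r =>
    (r.1, fun i => (r.2 i).apply v.length (c.2 i))

/-- After exactly `t` steps on `v` from the given configuration the automaton is in its accepting
state. -/
def AcceptsIn (M : MultiheadAutomaton Γ k) (v : List Γ) : ℕ → M.Config → Prop
  | 0, c => c.1 = M.accept
  | t + 1, c => ∃ d, M.step v c = some d ∧ AcceptsIn M v t d

/-- The automaton eventually reaches its accepting state on `v` from the given configuration. -/
def AcceptsFrom (M : MultiheadAutomaton Γ k) (v : List Γ) (c : M.Config) : Prop :=
  ∃ t, M.AcceptsIn v t c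

/-- The words accepted from the initial configuration. -/
def language (M : MultiheadAutomaton Γ k) : Language Γ :=
  {v | M.AcceptsFrom v M.initial}

variable (M : MultiheadAutomaton Γ k)

theorem acceptsFrom_of_accept {v : List Γ} {c : M.Config} (h : c.1 = M.accept) :
    M.AcceptsFrom v c :=
  ⟨0, h⟩

theorem acceptsFrom_iff_step {v : List Γ} {c : M.Config} (h : c.1 ≠ M.accept) :
    M.AcceptsFrom v c ↔ ∃ d, M.step v c = some d ∧ M.AcceptsFrom v d := by
  constructor
  · rintro ⟨_ | t, ht⟩
    · exact absurd ht h
    · obtain ⟨d, hd, ht⟩ := ht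
      exact ⟨d, hd, t, ht⟩
  · rintro ⟨d, hd, t, ht⟩
    exact ⟨t + 1, d, hd, ht⟩

theorem acceptsIn_iff_iterate (v : List Γ) (t : ℕ) (c : M.Config) :
    M.AcceptsIn v t c ↔
      ∃ d, (fun o : Option M.Config => o.bind (M.step v))^[t] (some c) = some d ∧
        d.1 = M.accept := by
  induction t generalizing c with
  | zero => simp [AcceptsIn]
  | succ t ih =>
    simp only [AcceptsIn, Function.iterate_succ, Function.comp_apply, Option.bind_some]
    constructor
    · rintro ⟨d, hd, h⟩
      rw [hd]
      exact (ih d).1 h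
    · rintro ⟨e, he, h⟩
      cases hs : M.step v c with
      | none =>
        rw [hs, Function.iterate_fixed rfl] at he
        cases he
      | some d =>
        rw [hs] at he
        exact ⟨d, rfl, (ih d).2 ⟨e, he, h⟩⟩

theorem _root_.HeadMove.apply_le (n : ℕ) (m : HeadMove) {p : ℕ} (hp : p ≤ n + 1) :
    m.apply n p ≤ n + 1 := by
  cases m <;> simp only [HeadMove.apply] <;> omega

theorem step_le {v : List Γ} {c d : M.Config} (h : M.step v c = some d)
    (hc : ∀ i, c.2 i ≤ v.length + 1) (i : Fin (k + 1)) : d.2 i ≤ v.length + 1 := by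
  simp only [step, Option.map_eq_some_iff] at h
  obtain ⟨r, -, rfl⟩ := h
  exact HeadMove.apply_le _ _ (hc i)

theorem iterate_step_le {v : List Γ} {c : M.Config} (hc : ∀ i, c.2 i ≤ v.length + 1) (t : ℕ)
    {d : M.Config}
    (h : (fun o : Option M.Config => o.bind (M.step v))^[t] (some c) = some d) :
    ∀ i, d.2 i ≤ v.length + 1 := by
  induction t generalizing d with
  | zero =>
    cases h
    exact hc
  | succ t ih =>
    rw [Function.iterate_succ', Function.comp_apply, Option.bind_eq_some_iff] at h
    obtain ⟨e, he, hd⟩ := h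
    exact M.step_le hd (ih he)

/-- An accepting computation of minimal length repeats no configuration, so its length is less than
the number of configurations. -/
theorem exists_acceptsIn_le {v : List Γ} (h : v ∈ M.language) :
    ∃ t ≤ Nat.card M.State * (v.length + 2) ^ (k + 1), M.AcceptsIn v t M.initial := by
  classical
  have := M.finite_state
  have h' : ∃ t, M.AcceptsIn v t M.initial := h
  refine ⟨Nat.find h', ?_, Nat.find_spec h'⟩
  set t := Nat.find h' with ht
  set g : Option M.Config → Option M.Config := fun o => o.bind (M.step v) with hg
  obtain ⟨e, he, hacc⟩ := (M.acceptsIn_iff_iterate v t _).1 (Nat.find_spec h')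
  have hsome : ∀ i : Fin t, ∃ d, g^[i] (some M.initial) = some d := by
    intro i
    rw [← Option.isSome_iff_exists]
    by_contra hnone
    rw [Option.not_isSome_iff_eq_none] at hnone
    have : g^[t] (some M.initial) = none := by
      rw [show t = (t - i) + i by omega, Function.iterate_add_apply, hnone,
        Function.iterate_fixed rfl]
    rw [this] at he
    cases he
  choose d hd using hsome
  have hle : ∀ i j, (d i).2 j < v.length + 2 := fun i j =>
    Nat.lt_succ_of_le (M.iterate_step_le (c := M.initial) (by simp [initial]) i (hd i) j)
  let F : Fin t → M.State × (Fin (k + 1) → Fin (v.length + 2)) :=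
    fun i => ((d i).1, fun j => ⟨(d i).2 j, hle i j⟩)
  have key : ∀ i j : Fin t, i < j → d i ≠ d j := by
    intro i j hij heq
    have h2 : g^[t - j + i] (some M.initial) = some e := by
      rw [Function.iterate_add_apply, hd i, heq, ← hd j, ← Function.iterate_add_apply,
        show t - j + j = t by omega, he]
    exact Nat.find_min h' (m := t - j + i) (by omega)
      ((M.acceptsIn_iff_iterate v _ _).2 ⟨e, h2, hacc⟩)
  have hF : Function.Injective F := by
    intro i j hij
    have hdd : d i = d j := by
      simp only [F, Prod.mk.injEq, funext_iff, Fin.mk.injEq] at hij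
      exact Prod.ext hij.1 (funext hij.2)
    rcases lt_trichotomy i j with h | h | h
    · exact absurd hdd (key i j h)
    · exact h
    · exact absurd hdd.symm (key j i h)
  have := Nat.card_le_card_of_injective F hF
  simpa [Nat.card_prod, Nat.card_fun] using this

end MultiheadAutomaton

/-! ### Simulation by a nondeterministic Turing machine -/

theorem Cell.finite (Γ : Type u) [Finite Γ] : Finite (Cell Γ) := by
  refine Finite.of_surjective
    (fun o : Option (Option Γ) => match o with
      | none => Cell.leftEnd
      | some none => Cell.rightEnd
      | some (some g) => Cell.letter g) ?_
  rintro (_ | _ | g)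
  exacts [⟨none, rfl⟩, ⟨some none, rfl⟩, ⟨some (some g), rfl⟩]

/-- The states of the Turing machine that guesses a word and runs a multihead automaton on it. -/
inductive GuessState (Q : Type u) : Type u
  /-- the input is being replaced by the guessed word -/
  | guess
  /-- the heads return to the beginning of the word -/
  | rewind
  /-- the automaton runs -/
  | run (q : Q)

theorem GuessState.finite (Q : Type u) [Finite Q] : Finite (GuessState Q) := by
  refine Finite.of_surjective
    (fun o : Option (Option Q) => match o with
      | none => GuessState.guess
      | some none => GuessState.rewind
      | some (some q) => GuessState.run q) ?_
  rintro (_ | _ | q)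
  exacts [⟨none, rfl⟩, ⟨some none, rfl⟩, ⟨some (some q), rfl⟩]

/-- The movement a Turing machine has to make so that the head does not leave the word. -/
def Cell.clamp {Γ : Type u} : Cell Γ → HeadMove → HeadMove
  | Cell.leftEnd, HeadMove.left => HeadMove.stay
  | Cell.rightEnd, HeadMove.right => HeadMove.stay
  | _, m => m

theorem Cell.clamp_toInt {Γ : Type u} (v : List Γ) (m : HeadMove) {p : ℕ} (hp : p ≤ v.length + 1) :
    (p : ℤ) - 1 + ((cellAt v p).clamp m).toInt = (m.apply v.length p : ℤ) - 1 := by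
  rcases p with _ | p
  · cases m <;> simp [cellAt, clamp, HeadMove.toInt, HeadMove.apply]
  · rcases eq_or_lt_of_le (Nat.le_of_succ_le_succ hp) with rfl | h <;> cases m <;>
      simp [cellAt, clamp, HeadMove.toInt, HeadMove.apply, *] <;> omega

namespace NTM

variable {α : Type u}

/-- Some computation of exactly `t` steps leads from `c` to the accepting state. -/
def AcceptsIn (M : NTM α) (t : ℕ) (c : M.Config) : Prop :=
  ∃ d, M.Run t c d ∧ d.state = M.accept

theorem acceptsIn_zero (M : NTM α) (c : M.Config) : M.AcceptsIn 0 c ↔ c.state = M.accept := by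
  constructor
  · rintro ⟨d, h, hd⟩
    cases h
    exact hd
  · exact fun h => ⟨c, Run.refl c, h⟩

theorem acceptsIn_succ (M : NTM α) (t : ℕ) (c : M.Config) :
    M.AcceptsIn (t + 1) c ↔ ∃ d, M.Step c d ∧ M.AcceptsIn t d := by
  constructor
  · rintro ⟨e, h, he⟩
    cases h with
    | head h₁ h₂ => exact ⟨_, h₁, e, h₂, he⟩
  · rintro ⟨d, h₁, e, h₂, he⟩
    exact ⟨e, Run.head h₁ h₂, he⟩

theorem acceptsIn_iff_of_ne (M : NTM α) {t : ℕ} {c : M.Config} (h : c.state ≠ M.accept) :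
    M.AcceptsIn t c ↔ ∃ s, t = s + 1 ∧ ∃ d, M.Step c d ∧ M.AcceptsIn s d := by
  cases t with
  | zero => simpa [acceptsIn_zero] using h
  | succ t => simp [acceptsIn_succ]

end NTM

namespace MultiheadAutomaton

variable {α Γ : Type u} {k : ℕ}

/-- The Turing machine that sweeps over its input `w`, replacing it on all tapes by a guessed word
`v` with `v.map π = w`, returns, marks the cell before the word, and runs `M` with its `i`-th head
on tape `i`. The blank serves as the right end marker. -/
abbrev toNTM (M : MultiheadAutomaton Γ k) (π : Γ → α) [Finite α] [Finite Γ] : NTM α where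
  workTapes := k
  State := GuessState M.State
  Symbol := α ⊕ Cell Γ
  finite_state :=
    haveI := M.finite_state
    GuessState.finite M.State
  finite_symbol :=
    haveI := Cell.finite Γ
    inferInstance
  blank := Sum.inr Cell.rightEnd
  letter := ⟨Sum.inl, Sum.inl_injective⟩
  letter_ne_blank := fun _ => Sum.inl_ne_inr
  start := GuessState.guess
  accept := GuessState.run M.accept
  trans := fun q s q' s' m =>
    match q with
    | GuessState.guess =>
      (∃ g, s 0 = Sum.inl (π g) ∧ q' = GuessState.guess ∧
        s' = (fun _ => Sum.inr (Cell.letter g)) ∧ m = fun _ => HeadMove.right) ∨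
      (s 0 = Sum.inr Cell.rightEnd ∧ q' = GuessState.rewind ∧ s' = s ∧ m = fun _ => HeadMove.left)
    | GuessState.rewind =>
      (∃ g, s 0 = Sum.inr (Cell.letter g) ∧ q' = GuessState.rewind ∧ s' = s ∧
        m = fun _ => HeadMove.left) ∨
      (s 0 = Sum.inr Cell.rightEnd ∧ q' = GuessState.run M.start ∧
        s' = (fun _ => Sum.inr Cell.leftEnd) ∧ m = fun _ => HeadMove.right)
    | GuessState.run q =>
      ∃ (c : Fin (k + 1) → Cell Γ) (r : M.State × (Fin (k + 1) → HeadMove)),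
        s = (fun i => Sum.inr (c i)) ∧ M.next q c = some r ∧ q' = GuessState.run r.1 ∧ s' = s ∧
          m = fun i => (c i).clamp (r.2 i)

variable [Finite α] [Finite Γ] (M : MultiheadAutomaton Γ k) (π : Γ → α)

/-- The tape content `v` from cell `0` on, with blanks elsewhere. -/
def wordTape {σ : Type u} (blank : σ) (v : List σ) (z : ℤ) : σ :=
  if 0 ≤ z then (v[z.toNat]?).getD blank else blank

/-- The guessing configuration in which `v` has been guessed and the input `w` is left. -/
def guessConfig (v : List Γ) (w : List α) : (M.toNTM π).Config where
  state := GuessState.guess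
  head := fun _ => (v.length : ℤ)
  tape := fun i =>
    wordTape (Sum.inr Cell.rightEnd)
      (v.map (fun g => Sum.inr (Cell.letter g)) ++ if i = 0 then w.map Sum.inl else [])

/-- The rewinding configuration with all heads in cell `j - 1`. -/
def rewindConfig (v : List Γ) (j : ℕ) : (M.toNTM π).Config where
  state := GuessState.rewind
  head := fun _ => (j : ℤ) - 1
  tape := fun _ => wordTape (Sum.inr Cell.rightEnd) (v.map fun g => Sum.inr (Cell.letter g))

/-- The configuration that represents the configuration `c` of the automaton. Position `p` of the
automaton is the cell `p - 1`. -/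
def runConfig (v : List Γ) (c : M.Config) : (M.toNTM π).Config where
  state := GuessState.run c.1
  head := fun i => (c.2 i : ℤ) - 1
  tape := fun _ z => if z < -1 then Sum.inr Cell.rightEnd else Sum.inr (cellAt v (z + 1).toNat)

theorem init_toNTM (w : List α) : (M.toNTM π).init w = M.guessConfig π [] w := by
  ext1
  · rfl
  · rfl
  · funext i z
    simp only [NTM.init, guessConfig, wordTape, toNTM]
    by_cases hz : 0 ≤ z <;> by_cases hi : i = 0 <;> simp [hz, hi]
    cases w[z.toNat]? <;> rfl

theorem wordTape_natCast {σ : Type u} (b : σ) (v : List σ) (j : ℕ) :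
    wordTape b v j = (v[j]?).getD b := by
  simp [wordTape]

theorem update_wordTape {σ : Type u} (b : σ) (v w : List σ) (s : σ) :
    Function.update (wordTape b (v ++ w)) (v.length : ℤ) s = wordTape b (v ++ s :: w.tail) := by
  funext z
  rcases lt_or_ge z 0 with hz | hz
  · rw [Function.update_of_ne (by omega)]
    simp [wordTape, not_le.2 hz]
  · obtain ⟨j, rfl⟩ := Int.eq_ofNat_of_zero_le hz
    by_cases hj : j = v.length
    · subst hj
      simp [wordTape_natCast]
    · rw [Function.update_of_ne (by omega), wordTape_natCast, wordTape_natCast]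
      rcases lt_or_ge j v.length with h | h
      · rw [List.getElem?_append_left h, List.getElem?_append_left h]
      · rw [List.getElem?_append_right h, List.getElem?_append_right h,
          show j - v.length = (j - v.length - 1) + 1 by omega]
        simp

theorem step_guessConfig_cons (v : List Γ) (a : α) (w : List α) (d : (M.toNTM π).Config) :
    (M.toNTM π).Step (M.guessConfig π v (a :: w)) d ↔
      ∃ g, π g = a ∧ d = M.guessConfig π (v ++ [g]) w := by
  have hread : (M.guessConfig π v (a :: w)).tape 0 ((M.guessConfig π v (a :: w)).head 0) =
      Sum.inl a := by
    simp [guessConfig, wordTape_natCast, toNTM]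
  have hnext : ∀ g, ({ state := GuessState.guess
                       head := fun i => (M.guessConfig π v (a :: w)).head i + HeadMove.right.toInt
                       tape := fun i => Function.update ((M.guessConfig π v (a :: w)).tape i)
                         ((M.guessConfig π v (a :: w)).head i) (Sum.inr (Cell.letter g)) } :
                      (M.toNTM π).Config) = M.guessConfig π (v ++ [g]) w := by
    intro g
    ext1
    · rfl
    · funext i
      simp [guessConfig, HeadMove.toInt]
    · funext i
      have := update_wordTape (Sum.inr Cell.rightEnd)
        (v.map fun g => (Sum.inr (Cell.letter g) : α ⊕ Cell Γ))
        (if i = 0 then (a :: w).map Sum.inl else []) (Sum.inr (Cell.letter g))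
      rw [List.length_map] at this
      simp only [guessConfig]
      refine this.trans ?_
      by_cases hi : i = 0 <;> simp [hi]
  constructor
  · rintro ⟨q, s, m, h | h, rfl⟩
    · obtain ⟨g, h0, rfl, rfl, rfl⟩ := h
      exact ⟨g, (Sum.inl_injective (hread.symm.trans h0)).symm, hnext g⟩
    · exact absurd (hread.symm.trans h.1) Sum.inl_ne_inr
  · rintro ⟨g, rfl, rfl⟩
    exact ⟨GuessState.guess, fun _ => Sum.inr (Cell.letter g), fun _ => HeadMove.right,
      Or.inl ⟨g, hread, rfl, rfl, rfl⟩, (hnext g).symm⟩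

theorem step_guessConfig_nil (v : List Γ) (d : (M.toNTM π).Config) :
    (M.toNTM π).Step (M.guessConfig π v []) d ↔ d = M.rewindConfig π v v.length := by
  have hread : (M.guessConfig π v []).tape 0 ((M.guessConfig π v []).head 0) =
      Sum.inr Cell.rightEnd := by
    simp [guessConfig, wordTape_natCast, toNTM]
  have hnext : ({ state := GuessState.rewind
                  head := fun i => (M.guessConfig π v []).head i + HeadMove.left.toInt
                  tape := fun i => Function.update ((M.guessConfig π v []).tape i)
                    ((M.guessConfig π v []).head i)
                    ((M.guessConfig π v []).tape i ((M.guessConfig π v []).head i)) } :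
                  (M.toNTM π).Config) = M.rewindConfig π v v.length := by
    ext1
    · rfl
    · rfl
    · funext i
      refine (Function.update_eq_self _ _).trans ?_
      simp [guessConfig, rewindConfig]
  constructor
  · rintro ⟨q, s, m, h | h, rfl⟩
    · obtain ⟨g, h0, -⟩ := h
      exact absurd (hread.symm.trans h0) Sum.inr_ne_inl
    · obtain ⟨-, rfl, rfl, rfl⟩ := h
      exact hnext
  · rintro rfl
    exact ⟨GuessState.rewind, _, fun _ => HeadMove.left, Or.inr ⟨hread, rfl, rfl, rfl⟩,
      hnext.symm⟩

theorem step_rewindConfig_succ (v : List Γ) {j : ℕ} (hj : j < v.length)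
    (d : (M.toNTM π).Config) :
    (M.toNTM π).Step (M.rewindConfig π v (j + 1)) d ↔ d = M.rewindConfig π v j := by
  have hread : (M.rewindConfig π v (j + 1)).tape 0 ((M.rewindConfig π v (j + 1)).head 0) =
      Sum.inr (Cell.letter v[j]) := by
    simp [rewindConfig, wordTape_natCast, hj]
  have hnext : ({ state := GuessState.rewind
                  head := fun i => (M.rewindConfig π v (j + 1)).head i + HeadMove.left.toInt
                  tape := fun i => Function.update ((M.rewindConfig π v (j + 1)).tape i)
                    ((M.rewindConfig π v (j + 1)).head i)
                    ((M.rewindConfig π v (j + 1)).tape i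
                      ((M.rewindConfig π v (j + 1)).head i)) } :
                  (M.toNTM π).Config) = M.rewindConfig π v j := by
    ext1
    · rfl
    · funext i
      simp [rewindConfig, HeadMove.toInt, sub_eq_add_neg]
    · funext i
      exact Function.update_eq_self _ _
  constructor
  · rintro ⟨q, s, m, h | h, rfl⟩
    · obtain ⟨g, -, rfl, rfl, rfl⟩ := h
      exact hnext
    · exact absurd (hread.symm.trans h.1) (by simp)
  · rintro rfl
    exact ⟨GuessState.rewind, _, fun _ => HeadMove.left,
      Or.inl ⟨v[j], hread, rfl, rfl, rfl⟩, hnext.symm⟩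

theorem step_rewindConfig_zero (v : List Γ) (d : (M.toNTM π).Config) :
    (M.toNTM π).Step (M.rewindConfig π v 0) d ↔ d = M.runConfig π v M.initial := by
  have hread : (M.rewindConfig π v 0).tape 0 ((M.rewindConfig π v 0).head 0) =
      Sum.inr Cell.rightEnd := by
    simp [rewindConfig, wordTape]
  have hnext : ({ state := GuessState.run M.start
                  head := fun i => (M.rewindConfig π v 0).head i + HeadMove.right.toInt
                  tape := fun i => Function.update ((M.rewindConfig π v 0).tape i)
                    ((M.rewindConfig π v 0).head i) (Sum.inr Cell.leftEnd) } :
                  (M.toNTM π).Config) = M.runConfig π v M.initial := by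
    ext1
    · rfl
    · funext i
      simp [rewindConfig, runConfig, HeadMove.toInt, initial]
    · funext i z
      simp only [rewindConfig, runConfig, Nat.cast_zero, zero_sub]
      rcases lt_trichotomy z (-1) with hz | rfl | hz
      · rw [Function.update_of_ne hz.ne, if_pos hz, wordTape, if_neg (by omega)]
      · simp [cellAt]
      · obtain ⟨j, rfl⟩ := Int.eq_ofNat_of_zero_le (show 0 ≤ z by omega)
        rw [Function.update_of_ne hz.ne', if_neg (by omega), wordTape_natCast]
        change _ = Sum.inr (cellAt v (j + 1))
        simp only [List.getElem?_map, cellAt]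
        cases v[j]? <;> rfl
  constructor
  · rintro ⟨q, s, m, h | h, rfl⟩
    · obtain ⟨g, h0, -⟩ := h
      exact absurd (hread.symm.trans h0) (by simp)
    · obtain ⟨-, rfl, rfl, rfl⟩ := h
      exact hnext
  · rintro rfl
    exact ⟨GuessState.run M.start, fun _ => Sum.inr Cell.leftEnd, fun _ => HeadMove.right,
      Or.inr ⟨hread, rfl, rfl, rfl⟩, hnext.symm⟩

theorem step_runConfig (v : List Γ) {c : M.Config} (hc : ∀ i, c.2 i ≤ v.length + 1)
    (d : (M.toNTM π).Config) :
    (M.toNTM π).Step (M.runConfig π v c) d ↔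
      ∃ e, M.step v c = some e ∧ d = M.runConfig π v e := by
  have hread : (fun i => (M.runConfig π v c).tape i ((M.runConfig π v c).head i)) =
      fun i => Sum.inr (cellAt v (c.2 i)) := by
    funext i
    simp only [runConfig]
    rw [if_neg (by omega), sub_add_cancel, Int.toNat_natCast]
  have hnext : ∀ r : M.State × (Fin (k + 1) → HeadMove),
      ({ state := GuessState.run r.1
         head := fun i => (M.runConfig π v c).head i + ((cellAt v (c.2 i)).clamp (r.2 i)).toInt
         tape := fun i => Function.update ((M.runConfig π v c).tape i)
           ((M.runConfig π v c).head i)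
           ((M.runConfig π v c).tape i ((M.runConfig π v c).head i)) } :
        (M.toNTM π).Config) =
        M.runConfig π v (r.1, fun i => (r.2 i).apply v.length (c.2 i)) := by
    intro r
    ext1
    · rfl
    · funext i
      exact Cell.clamp_toInt v (r.2 i) (hc i)
    · funext i
      exact Function.update_eq_self _ _
  constructor
  · rintro ⟨q, s, m, ⟨cs, r, h0, hr, rfl, rfl, rfl⟩, rfl⟩
    have hcs : cs = fun i => cellAt v (c.2 i) := by
      funext i
      exact (Sum.inr_injective (congrFun (hread.symm.trans h0) i)).symm
    subst hcs
    exact ⟨_, by simp only [step, hr, Option.map_some], hnext r⟩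
  · rintro ⟨e, he, rfl⟩
    simp only [step, Option.map_eq_some_iff] at he
    obtain ⟨r, hr, rfl⟩ := he
    exact ⟨GuessState.run r.1, _, fun i => (cellAt v (c.2 i)).clamp (r.2 i),
      ⟨_, r, hread, hr, rfl, rfl, rfl⟩, (hnext r).symm⟩

theorem acceptsIn_runConfig (v : List Γ) (t : ℕ) {c : M.Config}
    (hc : ∀ i, c.2 i ≤ v.length + 1) :
    (M.toNTM π).AcceptsIn t (M.runConfig π v c) ↔ M.AcceptsIn v t c := by
  induction t generalizing c with
  | zero =>
    rw [NTM.acceptsIn_zero, AcceptsIn]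
    exact ⟨fun h => GuessState.run.inj h, fun h => congrArg GuessState.run h⟩
  | succ t ih =>
    rw [NTM.acceptsIn_succ, AcceptsIn]
    simp only [M.step_runConfig π v hc]
    constructor
    · rintro ⟨_, ⟨e, he, rfl⟩, h⟩
      exact ⟨e, he, (ih (M.step_le he hc)).1 h⟩
    · rintro ⟨e, he, h⟩
      exact ⟨_, ⟨e, he, rfl⟩, (ih (M.step_le he hc)).2 h⟩

theorem acceptsIn_rewindConfig (v : List Γ) (t : ℕ) {j : ℕ} (hj : j ≤ v.length) :
    (M.toNTM π).AcceptsIn t (M.rewindConfig π v j) ↔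
      ∃ s, t = j + 1 + s ∧ M.AcceptsIn v s M.initial := by
  induction j generalizing t with
  | zero =>
    rw [NTM.acceptsIn_iff_of_ne _ (fun h => by cases h)]
    simp only [M.step_rewindConfig_zero π, exists_eq_left]
    refine exists_congr fun s => and_congr (by rw [zero_add, add_comm]) ?_
    exact M.acceptsIn_runConfig π v s (by simp [initial])
  | succ j ih =>
    rw [NTM.acceptsIn_iff_of_ne _ (fun h => by cases h)]
    simp only [M.step_rewindConfig_succ π v hj, exists_eq_left, ih _ (Nat.le_of_succ_le hj)]
    constructor
    · rintro ⟨_, rfl, s, rfl, h⟩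
      exact ⟨s, by omega, h⟩
    · rintro ⟨s, rfl, h⟩
      exact ⟨j + 1 + s, by omega, s, rfl, h⟩

theorem acceptsIn_guessConfig (v : List Γ) (w : List α) (t : ℕ) :
    (M.toNTM π).AcceptsIn t (M.guessConfig π v w) ↔
      ∃ v', v'.map π = w ∧
        ∃ s, t = w.length + ((v ++ v').length + 2) + s ∧ M.AcceptsIn (v ++ v') s M.initial := by
  induction w generalizing v t with
  | nil =>
    rw [NTM.acceptsIn_iff_of_ne _ (fun h => by cases h)]
    simp only [M.step_guessConfig_nil π, exists_eq_left, M.acceptsIn_rewindConfig π v _ le_rfl,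
      List.map_eq_nil_iff, List.append_nil, List.length_nil]
    constructor
    · rintro ⟨_, rfl, s, rfl, h⟩
      exact ⟨s, by omega, h⟩
    · rintro ⟨s, rfl, h⟩
      exact ⟨v.length + 1 + s, by omega, s, rfl, h⟩
  | cons a w ih =>
    rw [NTM.acceptsIn_iff_of_ne _ (fun h => by cases h)]
    simp only [M.step_guessConfig_cons π]
    constructor
    · rintro ⟨s, rfl, _, ⟨g, rfl, rfl⟩, h⟩
      obtain ⟨v', rfl, s', rfl, h'⟩ := (ih _ _).1 h
      exact ⟨g :: v', rfl, s', by grind, by simpa using h'⟩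
    · rintro ⟨v', hv', s, rfl, h⟩
      obtain ⟨g, v', rfl, rfl, rfl⟩ := List.map_eq_cons_iff.1 hv'
      refine ⟨v'.length + ((v ++ g :: v').length + 2) + s, by grind, _,
        ⟨g, rfl, rfl⟩, ?_⟩
      exact (ih _ _).2 ⟨v', rfl, s, by simp, by simpa using h⟩

/-- The image of the language of a multihead automaton under a letter-to-letter map is in NP. -/
theorem inNP_map_language : InNP ({w | ∃ v ∈ M.language, v.map π = w} : Language α) := by
  refine ⟨M.toNTM π, 2 * Polynomial.X + 2 +
    Polynomial.C (Nat.card M.State) * (Polynomial.X + 2) ^ (k + 1), fun w => ⟨?_, ?_⟩⟩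
  · constructor
    · rintro ⟨_, t, -, c, hrun, hacc⟩
      have h : (M.toNTM π).AcceptsIn t (M.guessConfig π [] w) := by
        rw [← M.init_toNTM π]
        exact ⟨c, hrun, hacc⟩
      obtain ⟨v, hv, s, -, hs⟩ := (M.acceptsIn_guessConfig π _ _ _).1 h
      exact ⟨v, ⟨s, hs⟩, hv⟩
    · rintro ⟨v, ⟨s, hs⟩, hv⟩
      obtain ⟨c, hrun, hacc⟩ := (M.acceptsIn_guessConfig π [] w _).2 ⟨v, hv, s, rfl, hs⟩
      rw [← M.init_toNTM π] at hrun
      exact ⟨_, _, le_rfl, c, hrun, hacc⟩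
  · rintro ⟨v, hv, rfl⟩
    obtain ⟨s, hle, hs⟩ := M.exists_acceptsIn_le hv
    obtain ⟨c, hrun, hacc⟩ := (M.acceptsIn_guessConfig π [] _ _).2 ⟨v, rfl, s, rfl, hs⟩
    rw [← M.init_toNTM π] at hrun
    refine ⟨_, ?_, c, hrun, hacc⟩
    simp only [List.nil_append, List.length_map, Polynomial.eval_add, Polynomial.eval_mul,
      Polynomial.eval_pow, Polynomial.eval_X, Polynomial.eval_C, Polynomial.eval_ofNat]
    omega

end MultiheadAutomaton

/-! ### A three-head automaton for triple conditions on matrices -/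

/-- The word that lists the given rows, each followed by the separator `none`. -/
def rowsWord {G : Type u} (rows : List (List G)) : List (Option G) :=
  (rows.map fun r => r.map some ++ [none]).flatten

theorem exists_rowsWord_eq {G : Type u} (v : List (Option G))
    (hv : v = [] ∨ v.getLast? = some none) : ∃ rows, rowsWord rows = v := by
  induction v with
  | nil => exact ⟨[], rfl⟩
  | cons a v ih =>
    rcases eq_or_ne v [] with rfl | hne
    · obtain rfl : a = none := by simpa using hv
      exact ⟨[[]], rfl⟩
    · obtain ⟨b, v, rfl⟩ := List.exists_cons_of_ne_nil hne
      obtain ⟨rows, hrows⟩ := ih (by simpa using hv)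
      cases a with
      | none => exact ⟨[] :: rows, by simp [← hrows, rowsWord]⟩
      | some g =>
        cases rows with
        | nil => simp [rowsWord] at hrows
        | cons r rows => exact ⟨(g :: r) :: rows, by simp [← hrows, rowsWord]⟩

theorem Network.encode_eq_rowsWord {G : Type u} {n : ℕ} (lab : Network (Fin n) G) :
    lab.encode = rowsWord (List.ofFn fun x => List.ofFn fun y => lab x y) := by
  simp [Network.encode, rowsWord, List.map_ofFn, Function.comp_def]

/-- From position `p` on, the word `v` reads `r` followed by a separator. -/
def ReadsRow {G : Type u} (v : List (Option G)) : ℕ → List G → Prop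
  | p, [] => cellAt v p = Cell.letter none
  | p, g :: r => cellAt v p = Cell.letter (some g) ∧ ReadsRow v (p + 1) r

/-- From position `p` on, the word `v` consists of the given rows, each followed by a separator. -/
def ReadsRows {G : Type u} (v : List (Option G)) : ℕ → List (List G) → Prop
  | p, [] => cellAt v p = Cell.rightEnd
  | p, r :: rows => ReadsRow v p r ∧ ReadsRows v (p + r.length + 1) rows

theorem readsRow_append {G : Type u} (u : List (Option G)) (r : List G) (w : List (Option G)) :
    ReadsRow (u ++ (r.map some ++ none :: w)) (u.length + 1) r := by
  induction r generalizing u with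
  | nil => simp [ReadsRow, cellAt]
  | cons g r ih =>
    refine ⟨by simp [cellAt], ?_⟩
    simpa using ih (u ++ [some g])

theorem readsRows_append {G : Type u} (u : List (Option G)) (rows : List (List G)) :
    ReadsRows (u ++ rowsWord rows) (u.length + 1) rows := by
  induction rows generalizing u with
  | nil => simp [ReadsRows, rowsWord, cellAt]
  | cons r rows ih =>
    have h : rowsWord (r :: rows) = r.map some ++ none :: rowsWord rows := by simp [rowsWord]
    refine ⟨by rw [h]; exact readsRow_append u r _, ?_⟩
    have := ih (u ++ (r.map some ++ [none]))
    rw [h]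
    simpa [add_assoc, add_comm, add_left_comm] using this

theorem ReadsRow.cellAt_add_length {G : Type u} {v : List (Option G)} {p : ℕ} {r : List G}
    (h : ReadsRow v p r) : cellAt v (p + r.length) = Cell.letter none := by
  induction r generalizing p with
  | nil => exact h
  | cons g r ih =>
    have := ih h.2
    rwa [List.length_cons, add_comm r.length, ← add_assoc]

theorem ReadsRow.cellAt_add {G : Type u} {v : List (Option G)} {p : ℕ} {r : List G}
    (h : ReadsRow v p r) {i : ℕ} (hi : i < r.length) :
    ∃ g, cellAt v (p + i) = Cell.letter (some g) := by
  induction r generalizing p i with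
  | nil => simp at hi
  | cons g r ih =>
    cases i with
    | zero => exact ⟨g, h.1⟩
    | succ i =>
      rw [add_comm i, ← add_assoc]
      exact ih h.2 (by simpa using hi)

theorem HeadMove.apply_right_of_cellAt {Γ : Type u} {v : List Γ} {p : ℕ} {g : Γ}
    (h : cellAt v p = Cell.letter g) : HeadMove.right.apply v.length p = p + 1 := by
  cases p with
  | zero => simp [cellAt] at h
  | succ p =>
    have hp : p < v.length := by
      by_contra hp
      simp [cellAt, hp] at h
    simp only [HeadMove.apply]
    omega

/-- The states of the automaton `matrixChecker`. The Boolean records whether the current row is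
known to have an entry of the required kind. -/
inductive CheckerState : Type u
  /-- the computation begins -/
  | start
  /-- head `0` is where a row may begin -/
  | row
  /-- head `0` is on an entry of a row or on the separator after it -/
  | entry (b : Bool)
  /-- head `2` moves to the beginning of its row -/
  | back (b : Bool)
  /-- heads `1` and `2` move along their rows in lockstep -/
  | scan (b : Bool)
  /-- head `1` moves to the first row -/
  | top
  | accept

theorem CheckerState.finite : Finite CheckerState.{u} := by
  refine Finite.of_surjective
    (fun s : Fin 4 ⊕ Fin 3 × Bool => match s with
      | Sum.inl 0 => CheckerState.start
      | Sum.inl 1 => CheckerState.row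
      | Sum.inl 2 => CheckerState.top
      | Sum.inl 3 => CheckerState.accept
      | Sum.inr (0, b) => CheckerState.entry b
      | Sum.inr (1, b) => CheckerState.back b
      | Sum.inr (2, b) => CheckerState.scan b) ?_
  rintro (_ | _ | b | b | b | _ | _)
  exacts [⟨Sum.inl 0, rfl⟩, ⟨Sum.inl 1, rfl⟩, ⟨Sum.inr (0, b), rfl⟩, ⟨Sum.inr (1, b), rfl⟩,
    ⟨Sum.inr (2, b), rfl⟩, ⟨Sum.inl 2, rfl⟩, ⟨Sum.inl 3, rfl⟩]

open CheckerState HeadMove Cell in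
open scoped Classical in
/-- An automaton which checks that its input lists the rows of a square matrix `a` such that every
row has an entry with `R` and `P (a x y) (a y z) (a x z)` for all `x, y, z`; the empty matrix
passes if `e`. While head `0` is on the entry `(x, y)`, head `1` moves along row `y` and head `2`
along row `x`. Head `1` then stands at the beginning of row `y + 1`, and so the matrix is square if
head `1` reaches the end of the word exactly when head `0` reaches the end of row `x`. -/
noncomputable abbrev matrixChecker {G : Type u} (e : Prop) (R : G → Prop) (P : G → G → G → Prop) :
    MultiheadAutomaton (Option G) 2 where
  State := CheckerState.{u}
  finite_state := CheckerState.finite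
  start := start
  accept := accept
  next := fun q h => match q, h 0, h 1, h 2 with
    | start, rightEnd, _, _ => if e then some (accept, ![stay, stay, stay]) else none
    | start, _, _, _ => some (row, ![stay, stay, stay])
    | row, rightEnd, _, _ => some (accept, ![stay, stay, stay])
    | row, _, _, _ => some (entry false, ![stay, stay, stay])
    | entry b, letter (some g), _, _ => some (back (b || decide (R g)), ![stay, stay, left])
    | entry true, letter none, rightEnd, _ => some (top, ![right, left, right])
    | back b, _, _, letter (some _) => some (back b, ![stay, stay, left])
    | back b, _, _, _ => some (scan b, ![stay, stay, right])
    | scan b, letter (some g₁), letter (some g₂), letter (some g₃) =>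
      if P g₁ g₂ g₃ then some (scan b, ![stay, right, right]) else none
    | scan b, _, letter none, letter none => some (entry b, ![right, right, stay])
    | top, _, leftEnd, _ => some (row, ![stay, right, stay])
    | top, _, _, _ => some (top, ![stay, left, stay])
    | _, _, _, _ => none

namespace matrixChecker

open MultiheadAutomaton

variable {G : Type u} {e : Prop} {R : G → Prop} {P : G → G → G → Prop} {v : List (Option G)}

local notation "Acc" => MultiheadAutomaton.AcceptsFrom (matrixChecker e R P) v

theorem step_eq (q : CheckerState.{u}) (p₀ p₁ p₂ : ℕ) :
    (matrixChecker e R P).step v (q, ![p₀, p₁, p₂]) =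
      ((matrixChecker e R P).next q ![cellAt v p₀, cellAt v p₁, cellAt v p₂]).map fun r =>
        (r.1, ![(r.2 0).apply v.length p₀, (r.2 1).apply v.length p₁,
          (r.2 2).apply v.length p₂]) := by
  have hc : (fun i => cellAt v ((![p₀, p₁, p₂] : Fin 3 → ℕ) i)) =
      ![cellAt v p₀, cellAt v p₁, cellAt v p₂] := by
    funext i
    fin_cases i <;> rfl
  rw [← hc]
  rw [MultiheadAutomaton.step]
  congr 1
  funext r
  refine Prod.ext rfl (funext fun i => ?_)
  fin_cases i <;> rfl

theorem acceptsFrom_iff_of_next {q q' : CheckerState.{u}} {p₀ p₁ p₂ : ℕ} (m₀ m₁ m₂ : HeadMove)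
    (hq : q ≠ CheckerState.accept)
    (h : (matrixChecker e R P).next q ![cellAt v p₀, cellAt v p₁, cellAt v p₂] =
      some (q', ![m₀, m₁, m₂])) :
    Acc (q, ![p₀, p₁, p₂]) ↔
      Acc (q', ![m₀.apply v.length p₀, m₁.apply v.length p₁, m₂.apply v.length p₂]) := by
  rw [acceptsFrom_iff_step _ hq, step_eq, h]
  simp

theorem not_acceptsFrom_of_next {q : CheckerState.{u}} {p₀ p₁ p₂ : ℕ}
    (hq : q ≠ CheckerState.accept)
    (h : (matrixChecker e R P).next q ![cellAt v p₀, cellAt v p₁, cellAt v p₂] = none) :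
    ¬ Acc (q, ![p₀, p₁, p₂]) := by
  rw [acceptsFrom_iff_step _ hq, step_eq, h]
  simp

theorem acceptsFrom_top (p₀ p₁ p₂ : ℕ) :
    Acc (CheckerState.top, ![p₀, p₁, p₂]) ↔ Acc (CheckerState.row, ![p₀, 1, p₂]) := by
  induction p₁ with
  | zero =>
    rw [acceptsFrom_iff_of_next (q' := CheckerState.row) .stay .right .stay (by simp)
      (by simp [cellAt])]
    simp [HeadMove.apply]
  | succ p₁ ih =>
    rw [← ih, acceptsFrom_iff_of_next (q' := CheckerState.top) .stay .left .stay (by simp) ?_]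
    · simp [HeadMove.apply]
    · cases h : v[p₁]? <;> simp [cellAt, h]

theorem acceptsFrom_back (b : Bool) (p₀ p₁ q j : ℕ)
    (hq : ∀ g, cellAt v q ≠ Cell.letter (some g)) (hq' : q ≤ v.length)
    (hj : ∀ i < j, ∃ g, cellAt v (q + 1 + i) = Cell.letter (some g)) :
    Acc (CheckerState.back b, ![p₀, p₁, q + j]) ↔
      Acc (CheckerState.scan b, ![p₀, p₁, q + 1]) := by
  induction j with
  | zero =>
    rw [acceptsFrom_iff_of_next (q' := CheckerState.scan b) .stay .stay .right (by simp) ?_]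
    · simp [HeadMove.apply, hq']
    · rw [add_zero]
      rcases h : cellAt v q with _ | _ | _ | g
      · simp
      · simp
      · simp
      · exact absurd h (hq g)
  | succ j ih =>
    obtain ⟨g, hg⟩ := hj j (by omega)
    rw [← ih fun i hi => hj i (by omega), acceptsFrom_iff_of_next (q' := CheckerState.back b)
      .stay .stay .left (by simp) ?_]
    · simp [HeadMove.apply]
    · rw [show q + (j + 1) = q + 1 + j by omega, hg]
      simp

theorem acceptsFrom_scan (b : Bool) {p₀ p₁ p₂ : ℕ} {g : G} {r s : List G}
    (h₀ : cellAt v p₀ = Cell.letter (some g)) (h₁ : ReadsRow v p₁ r) (h₂ : ReadsRow v p₂ s) :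
    Acc (CheckerState.scan b, ![p₀, p₁, p₂]) ↔ List.Forall₂ (P g) r s ∧
      Acc (CheckerState.entry b, ![p₀ + 1, p₁ + r.length + 1, p₂ + s.length]) := by
  induction r generalizing p₁ p₂ s with
  | nil =>
    cases s with
    | nil =>
      rw [ReadsRow] at h₁ h₂
      rw [acceptsFrom_iff_of_next (q' := CheckerState.entry b) .right .right .stay (by simp)
        (by simp [h₀, h₁, h₂]),
        HeadMove.apply_right_of_cellAt h₀, HeadMove.apply_right_of_cellAt h₁]
      simp [HeadMove.apply]
    | cons g₃ s =>
      rw [ReadsRow] at h₁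
      simp only [List.forall₂_nil_left_iff, reduceCtorEq, false_and, iff_false]
      exact not_acceptsFrom_of_next (by simp) (by simp [h₀, h₁, h₂.1])
  | cons g₂ r ih =>
    cases s with
    | nil =>
      rw [ReadsRow] at h₂
      simp only [List.forall₂_nil_right_iff, reduceCtorEq, false_and, iff_false]
      exact not_acceptsFrom_of_next (by simp) (by simp [h₀, h₁.1, h₂])
    | cons g₃ s =>
      rw [List.forall₂_cons]
      by_cases hP : P g g₂ g₃
      · rw [acceptsFrom_iff_of_next (q' := CheckerState.scan b) .stay .right .right (by simp)
          (by simp [h₀, h₁.1, h₂.1, hP]),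
          HeadMove.apply_right_of_cellAt h₁.1, HeadMove.apply_right_of_cellAt h₂.1]
        simp only [HeadMove.apply, hP, true_and, List.length_cons]
        rw [ih h₁.2 h₂.2, add_right_comm p₁ 1, add_right_comm p₂ 1, ← add_assoc p₁, ← add_assoc p₂]
      · simp only [hP, false_and, iff_false]
        exact not_acceptsFrom_of_next (by simp) (by simp [h₀, h₁.1, h₂.1, hP])

/-- The automaton processes the entries `rest` of a row `r`, comparing `r` for each of them with one
of the rows `rows`. Head `2` is anywhere in the row `r`. -/
theorem acceptsFrom_entry (b : Bool) {p₀ p₁ q j : ℕ} {rest r : List G} {rows : List (List G)}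
    (h₀ : ReadsRow v p₀ rest) (h₁ : ReadsRows v p₁ rows)
    (hq : ∀ g, cellAt v q ≠ Cell.letter (some g)) (hr : ReadsRow v (q + 1) r)
    (hj : j ≤ r.length) (hj' : rest = [] → j = r.length) :
    Acc (CheckerState.entry b, ![p₀, p₁, q + 1 + j]) ↔
      List.Forall₂ (fun g s => List.Forall₂ (P g) s r) rest rows ∧
      (b = true ∨ ∃ g ∈ rest, R g) ∧
      Acc (CheckerState.row, ![p₀ + rest.length + 1, 1, q + 1 + r.length + 1]) := by
  have hqv : q ≤ v.length := by
    have hsep := hr.cellAt_add_length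
    by_contra hlt
    rw [add_right_comm, cellAt, List.getElem?_eq_none (by omega)] at hsep
    cases hsep
  induction rest generalizing b p₀ p₁ j rows with
  | nil =>
    rw [ReadsRow] at h₀
    rw [hj' rfl]
    cases b with
    | false =>
      simp only [Bool.false_eq_true, List.not_mem_nil, false_and, exists_false, or_self, and_false,
        iff_false]
      exact not_acceptsFrom_of_next (by simp) (by simp [h₀])
    | true =>
      cases rows with
      | nil =>
        rw [ReadsRows] at h₁
        rw [acceptsFrom_iff_of_next (q' := CheckerState.top) .right .left .right (by simp)
          (by simp [h₀, h₁]),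
          HeadMove.apply_right_of_cellAt h₀,
          HeadMove.apply_right_of_cellAt hr.cellAt_add_length, acceptsFrom_top]
        simp
      | cons s rows =>
        simp only [List.forall₂_nil_left_iff, reduceCtorEq, false_and, iff_false]
        refine not_acceptsFrom_of_next (by simp) ?_
        cases s with
        | nil => simp [h₀, show cellAt v p₁ = _ from h₁.1]
        | cons g s => simp [h₀, h₁.1.1]
  | cons g rest ih =>
    have hb : ∀ b' : Bool, Acc (CheckerState.back b', ![p₀, p₁, q + j]) ↔
        Acc (CheckerState.scan b', ![p₀, p₁, q + 1]) := fun b' =>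
      acceptsFrom_back b' p₀ p₁ q j hq hqv fun i hi => hr.cellAt_add (by omega)
    classical
    rw [acceptsFrom_iff_of_next (q' := CheckerState.back (b || decide (R g)))
      .stay .stay .left (by simp)
      (by simp [h₀.1])]
    simp only [HeadMove.apply, show q + 1 + j - 1 = q + j by omega, hb]
    cases rows with
    | nil =>
      rw [ReadsRows] at h₁
      simp only [List.forall₂_nil_right_iff, reduceCtorEq, false_and, iff_false]
      exact not_acceptsFrom_of_next (by simp) (by simp [h₀.1, h₁])
    | cons s rows =>
      have hrest := ih (b || decide (R g)) h₀.2 h₁.2 le_rfl fun _ => rfl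
      refine (acceptsFrom_scan _ h₀.1 h₁.1 hr).trans ((and_congr_right fun _ => hrest).trans ?_)
      rw [List.forall₂_cons, List.length_cons, add_right_comm p₀ 1, ← add_assoc p₀]
      simp only [Bool.or_eq_true, decide_eq_true_eq, List.exists_mem_cons_iff, or_assoc, and_assoc]

theorem acceptsFrom_row {q : ℕ} {rest rows : List (List G)} (h : ReadsRows v (q + 1) rest)
    (hrows : ReadsRows v 1 rows) (hq : ∀ g, cellAt v q ≠ Cell.letter (some g)) :
    Acc (CheckerState.row, ![q + 1, 1, q + 1]) ↔
      ∀ r ∈ rest, List.Forall₂ (fun g s => List.Forall₂ (P g) s r) r rows ∧ ∃ g ∈ r, R g := by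
  induction rest generalizing q with
  | nil =>
    rw [ReadsRows] at h
    simp only [List.not_mem_nil, false_imp_iff, implies_true, iff_true]
    rw [acceptsFrom_iff_of_next (q' := CheckerState.accept) .stay .stay .stay (by simp)
      (by simp [h])]
    exact acceptsFrom_of_accept _ rfl
  | cons r rest ih =>
    have hsep := h.1.cellAt_add_length
    rw [acceptsFrom_iff_of_next (q' := CheckerState.entry false) .stay .stay .stay (by simp) ?_]
    · have := acceptsFrom_entry (e := e) (R := R) (P := P) (j := 0) false h.1 hrows hq h.1
        (Nat.zero_le _) (fun h => by rw [h, List.length_nil])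
      simp only [add_zero] at this
      simp only [HeadMove.apply, List.forall_mem_cons]
      rw [this, ih h.2 (by simp [hsep])]
      simp [and_assoc]
    · cases r with
      | nil => simp [show cellAt v (q + 1) = _ from h.1]
      | cons g r => simp [h.1.1]

/-- Words that do not end with a separator are rejected: when a row begins, head `0` is on the
first letter or right of a separator. -/
theorem getLast?_of_acceptsIn (t : ℕ) (c : (matrixChecker e R P).Config)
    (hacc : (matrixChecker e R P).AcceptsIn v t c) (hle : c.2 0 ≤ v.length + 1)
    (hne : c.1 ≠ CheckerState.accept)
    (hrow : c.1 = CheckerState.start ∨ c.1 = CheckerState.row ∨ c.1 = CheckerState.top →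
      ∃ q, c.2 0 = q + 1 ∧ ∀ g, cellAt v q ≠ Cell.letter (some g)) :
    v = [] ∨ v.getLast? = some none := by
  have hend : ∀ q, q ≤ v.length → cellAt v (q + 1) = Cell.rightEnd →
      (∀ g, cellAt v q ≠ Cell.letter (some g)) → v = [] ∨ v.getLast? = some none := by
    intro q hq h hcell
    have hlen : q = v.length := by
      by_contra hlt
      rw [cellAt, List.getElem?_eq_getElem (by omega)] at h
      cases h
    subst hlen
    rcases List.eq_nil_or_concat v with rfl | ⟨u, a, rfl⟩
    · exact Or.inl rfl
    · cases a with
      | none => simp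
      | some g => exact absurd (by simp [cellAt]) (hcell g)
  induction t generalizing c with
  | zero => exact absurd hacc hne
  | succ t ih =>
    obtain ⟨⟨q, p⟩, hd, hacc⟩ := hacc
    obtain ⟨q₀, p₀⟩ := c
    simp only [MultiheadAutomaton.step, Option.map_eq_some_iff, Prod.mk.injEq] at hd
    obtain ⟨⟨q', m⟩, hr, rfl, rfl⟩ := hd
    dsimp only at hr hle hne hrow hacc
    have ih := ih _ hacc (HeadMove.apply_le _ _ hle)
    dsimp only at ih
    have hfinish : q₀ = CheckerState.start ∨ q₀ = CheckerState.row →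
        cellAt v (p₀ 0) = Cell.rightEnd → v = [] ∨ v.getLast? = some none := by
      intro hq₀ h
      obtain ⟨q, hq, hcell⟩ := hrow (hq₀.imp_right Or.inl)
      rw [hq] at h hle
      exact hend q (by omega) h hcell
    split at hr
    case h_1 h => exact hfinish (Or.inl rfl) h
    case h_3 h => exact hfinish (Or.inr rfl) h
    case h_9 =>
      split at hr
      · cases hr
        exact ih (by simp) (by simp)
      · cases hr
    case h_13 => cases hr
    all_goals cases hr
    case h_2.refl => exact ih (by simp) fun _ => hrow (by simp)
    case h_6.refl h _ =>
      exact ih (by simp) fun _ => ⟨p₀ 0, HeadMove.apply_right_of_cellAt h, by simp [h]⟩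
    case h_11.refl => exact ih (by simp) fun _ => hrow (by simp)
    case h_12.refl => exact ih (by simp) fun _ => hrow (by simp)
    all_goals exact ih (by simp) (by simp)

theorem rowsWord_mem_language (rows : List (List G)) :
    rowsWord rows ∈ (matrixChecker e R P).language ↔ (rows = [] → e) ∧
      ∀ r ∈ rows, List.Forall₂ (fun g s => List.Forall₂ (P g) s r) r rows ∧ ∃ g ∈ r, R g := by
  have hrows : ReadsRows (rowsWord rows) 1 rows := readsRows_append [] rows
  have hinit : (matrixChecker e R P).initial = (CheckerState.start, ![1, 1, 1]) :=
    Prod.ext rfl (funext fun i => by fin_cases i <;> rfl)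
  change (matrixChecker e R P).AcceptsFrom _ (matrixChecker e R P).initial ↔ _
  rw [hinit]
  cases rows with
  | nil =>
    have h : cellAt (rowsWord ([] : List (List G))) 1 = Cell.rightEnd := hrows
    by_cases he : e
    · rw [acceptsFrom_iff_of_next (q' := CheckerState.accept) .stay .stay .stay (by simp)
        (by simp [h, he])]
      simp [he, acceptsFrom_of_accept]
    · simp only [he, true_imp_iff, false_and, iff_false]
      exact not_acceptsFrom_of_next (by simp) (by simp [h, he])
  | cons r rows =>
    rw [acceptsFrom_iff_of_next (q' := CheckerState.row) .stay .stay .stay (by simp) ?_]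
    · simp only [HeadMove.apply]
      rw [acceptsFrom_row (q := 0) hrows hrows (by simp [cellAt])]
      simp
    · cases r with
      | nil => simp [show cellAt _ 1 = _ from hrows.1]
      | cons g r => simp [hrows.1.1]

end matrixChecker

theorem List.forall₂_ofFn {α β : Type*} {n : ℕ} {S : α → β → Prop} (f : Fin n → α)
    (g : Fin n → β) : List.Forall₂ S (List.ofFn f) (List.ofFn g) ↔ ∀ i, S (f i) (g i) := by
  simp [List.forall₂_iff_get, Fin.forall_iff]

theorem List.exists_eq_ofFn {α : Type*} {n : ℕ} (l : List α) (h : l.length = n) :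
    ∃ f : Fin n → α, l = List.ofFn f := by
  subst h
  exact ⟨l.get, (List.ofFn_get l).symm⟩

theorem matrixChecker_language {G : Type u} (e : Prop) (R : G → Prop) (P : G → G → G → Prop) :
    (matrixChecker e R P).language =
      {v | ∃ (n : ℕ) (lab : Network (Fin n) G), lab.encode = v ∧ (n = 0 → e) ∧
        (∀ x, ∃ y, R (lab x y)) ∧ ∀ x y z, P (lab x y) (lab y z) (lab x z)} := by
  ext v
  have key : ∀ (n : ℕ) (lab : Network (Fin n) G), lab.encode ∈ (matrixChecker e R P).language ↔
      (n = 0 → e) ∧ (∀ x, ∃ y, R (lab x y)) ∧ ∀ x y z, P (lab x y) (lab y z) (lab x z) := by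
    intro n lab
    rw [Network.encode_eq_rowsWord, matrixChecker.rowsWord_mem_language]
    simp only [List.ofFn_eq_nil_iff, Set.forall_mem_range, List.forall₂_ofFn,
      List.mem_ofFn', Set.exists_range_iff, forall_and, and_comm (a := ∀ x, ∃ y, R (lab x y))]
  constructor
  · intro hv
    have hlast : v = [] ∨ v.getLast? = some none := by
      obtain ⟨t, ht⟩ := id hv
      refine matrixChecker.getLast?_of_acceptsIn t _ ht (by simp [MultiheadAutomaton.initial])
        (by simp [MultiheadAutomaton.initial]) fun _ => ⟨0, rfl, by simp [cellAt]⟩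
    obtain ⟨rows, rfl⟩ := exists_rowsWord_eq v hlast
    have hlen : ∀ r ∈ rows, r.length = rows.length := fun r hr =>
      (((matrixChecker.rowsWord_mem_language rows).1 hv).2 r hr).1.length_eq
    obtain ⟨f, hf⟩ := List.exists_eq_ofFn rows rfl
    have hlab : ∀ x, ∃ g : Fin rows.length → G, f x = List.ofFn g := fun x =>
      List.exists_eq_ofFn _ (hlen _ (by rw [hf]; exact (List.mem_ofFn' f _).2 ⟨x, rfl⟩))
    choose lab hlab using hlab
    have henc : Network.encode lab = rowsWord rows := by
      rw [Network.encode_eq_rowsWord, ← funext hlab, ← hf]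
    exact ⟨rows.length, lab, henc, (key _ lab).1 (by rwa [henc])⟩
  · rintro ⟨n, lab, rfl, h⟩
    exact (key n lab).2 h

/-- It is in NP whether the entries of a square matrix over `A` can be annotated by elements of `B`
so that every row has an entry with `R` and `P` holds for all triples of entries at `(x, y)`,
`(y, z)`, `(x, z)`. The empty matrix is treated separately, by `e`. -/
theorem inNP_exists_triples {A B : Type u} [Finite A] [Finite B] (e : Prop) (R : A × B → Prop)
    (P : A × B → A × B → A × B → Prop) :
    InNP ({w | ∃ (n : ℕ) (lab : Network (Fin n) A), lab.encode = w ∧ (n = 0 → e) ∧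
      ∃ μ : Fin n → Fin n → B, (∀ x, ∃ y, R (lab x y, μ x y)) ∧
        ∀ x y z, P (lab x y, μ x y) (lab y z, μ y z) (lab x z, μ x z)} : Language (Option A)) := by
  have h := (matrixChecker e R P).inNP_map_language (Option.map Prod.fst)
  rw [matrixChecker_language] at h
  refine cast (congrArg (InNP (α := Option A)) (Set.ext fun w => Iff.symm ?_)) h
  have hmap : ∀ (n : ℕ) (lab : Network (Fin n) (A × B)),
      lab.encode.map (Option.map Prod.fst) = Network.encode fun x y => (lab x y).1 := by
    intro n lab
    simp [Network.encode, List.map_flatten, List.map_ofFn, Function.comp_def]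
  constructor
  · rintro ⟨n, lab, rfl, he, μ, hR, hP⟩
    exact ⟨_, ⟨n, fun x y => (lab x y, μ x y), rfl, he, hR, hP⟩, hmap n _⟩
  · rintro ⟨_, ⟨n, lab, rfl, he, hR, hP⟩, rfl⟩
    exact ⟨n, fun x y => (lab x y).1, (hmap n lab).symm, he, fun x y => (lab x y).2, hR, hP⟩

/-! ### Qualitative representations from labelled points -/

open NonassocRelAlgebra

section Consistency

variable {A : Type u} [NonassocRelAlgebra A]

/-- `ConsistentTriple s t r`: the sets `s`, `t`, `r` of algebra elements may be the sets of those
elements that hold at the pairs `(p, q)`, `(q, r)`, `(p, r)` of three points of a qualitative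
representation. Converse is handled through the triples in which the first and the last point
agree. -/
structure ConsistentTriple (s t r : Set A) : Prop where
  bot_notMem : ⊥ ∉ s
  top_mem : ⊤ ∈ s
  sup_mem_iff : ∀ a b, a ⊔ b ∈ s ↔ a ∈ s ∨ b ∈ s
  compl_mem_iff : ∀ a, aᶜ ∈ s ↔ a ∉ s
  comp_mem : ∀ a b c, comp a b ≤ c → a ∈ s → b ∈ t → c ∈ r
  conv_mem_iff : ident ∈ r → ∀ a, conv a ∈ s ↔ a ∈ t
  ident_mem : ident ∈ t → ident ∈ r → ident ∈ s

/-- All triples of points of `X`, with the pairs of points labelled by `δ`, are consistent. -/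
def Consistent {X : Type*} (δ : X → X → Set A) : Prop :=
  ∀ p q r, ConsistentTriple (δ p q) (δ q r) (δ p r)

/-- The set of elements of the algebra that hold at a pair of points. -/
def typeOf {D : Type*} (φ : A → SetRel D D) (p q : D) : Set A := {a | (p, q) ∈ φ a}

theorem IsQualitativeRep.consistent {D : Type u} {φ : A → SetRel D D} (h : IsQualitativeRep φ) :
    Consistent (typeOf φ) := by
  intro p q r
  have hid : ∀ p q, ident ∈ typeOf φ p q ↔ p = q := fun p q => by
    simp [typeOf, h.map_ident, SetRel.id]
  constructor
  · simp [typeOf, h.map_bot]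
  · simp [typeOf, h.map_top]
  · simp [typeOf, h.map_sup]
  · simp [typeOf, h.map_compl]
  · exact fun a b c habc ha hb => (h.comp_subset_iff a b c).2 habc ⟨q, ha, hb⟩
  · intro hpr a
    obtain rfl := (hid p r).1 hpr
    simp [typeOf, h.map_conv]
  · intro hqr hpr
    rw [hid] at *
    rw [hqr, hpr]

theorem Consistent.eq_of_subset {X : Type*} {δ : X → X → Set A} (h : Consistent δ)
    {p q p' q' : X} (hs : δ p q ⊆ δ p' q') : δ p q = δ p' q' := by
  refine hs.antisymm fun a ha => ?_
  by_contra hna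
  exact ((h p' q' q').compl_mem_iff a).1 (hs (((h p q q).compl_mem_iff a).2 hna)) ha

theorem Consistent.eq_of_ident_mem_left {X : Type*} {δ : X → X → Set A} (h : Consistent δ)
    {p q : X} (hpq : ident ∈ δ p q) (r : X) : δ q r = δ p r :=
  h.eq_of_subset fun b hb => (h p q r).comp_mem ident b b (ident_comp b).le hpq hb

theorem Consistent.eq_of_ident_mem_right {X : Type*} {δ : X → X → Set A} (h : Consistent δ)
    {p q : X} (hpq : ident ∈ δ p q) (r : X) : δ r p = δ r q :=
  h.eq_of_subset fun b hb => (h r p q).comp_mem b ident b (comp_ident b).le hb hpq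

/-- A consistent labelling in which points are identified by `1'` and every failure of `a ; b ≤ c`
is witnessed yields a qualitative representation, on the points modulo `1'`. -/
theorem Consistent.exists_isQualitativeRep {X : Type u} {δ : X → X → Set A} (h : Consistent δ)
    (hrefl : ∀ p, ident ∈ δ p p)
    (hwit : ∀ a b c, ¬ comp a b ≤ c → ∃ p q r, a ∈ δ p q ∧ b ∈ δ q r ∧ c ∉ δ p r) :
    ∃ (D : Type u) (φ : A → SetRel D D), IsQualitativeRep φ ∧
      ∃ π : X → D, ∀ p q, typeOf φ (π p) (π q) = δ p q := by
  let S : Setoid X :=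
    { r := fun p q => ident ∈ δ p q
      iseqv :=
        { refl := hrefl
          symm := fun {p q} hpq => by
            rw [h.eq_of_ident_mem_left hpq p]
            exact hrefl p
          trans := fun {p q r} hpq hqr => by
            rwa [← h.eq_of_ident_mem_left hpq r] } }
  let δ' : Quotient S → Quotient S → Set A := Quotient.lift₂ δ fun p q p' q' hp hq =>
    (h.eq_of_ident_mem_left hp q).symm.trans (h.eq_of_ident_mem_right hq p')
  let φ : A → SetRel (Quotient S) (Quotient S) := fun a => {x | a ∈ δ' x.1 x.2}
  have hmem : ∀ a p q, ((⟦p⟧, ⟦q⟧) : Quotient S × Quotient S) ∈ φ a ↔ a ∈ δ p q :=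
    fun a p q => Iff.rfl
  have hext : ∀ R T : SetRel (Quotient S) (Quotient S),
      (∀ p q : X, (⟦p⟧, ⟦q⟧) ∈ R ↔ (⟦p⟧, ⟦q⟧) ∈ T) → R = T := by
    rintro R T hRT
    ext ⟨x, y⟩
    induction x, y using Quotient.inductionOn₂ with
    | _ p q => exact hRT p q
  have hident : φ ident = SetRel.id := hext _ _ fun p q => by
    rw [hmem, SetRel.mem_id]
    exact (Quotient.eq (r := S)).symm
  have hcomp : ∀ a b c, SetRel.comp (φ a) (φ b) ⊆ φ c ↔ comp a b ≤ c := by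
    intro a b c
    constructor
    · intro hsub
      by_contra habc
      obtain ⟨p, q, r, ha, hb, hc⟩ := hwit a b c habc
      exact hc ((hmem c p r).1 (hsub ⟨⟦q⟧, (hmem a p q).2 ha, (hmem b q r).2 hb⟩))
    · rintro habc ⟨x, z⟩ ⟨y, hxy, hyz⟩
      induction x, y, z using Quotient.inductionOn₃ with
      | _ p q r => exact (h p q r).comp_mem a b c habc hxy hyz
  have hmono : ∀ a b, φ a ⊆ φ b → a ≤ b := by
    intro a b hab
    rw [← ident_comp a, ← hcomp, hident, SetRel.id_comp]
    exact hab
  refine ⟨Quotient S, φ, ⟨⟨Set.univ, ⟨trivial, fun _ _ _ _ => trivial, fun _ _ => trivial,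
    trivial, fun _ _ => trivial⟩, fun _ => trivial⟩, fun a b hab => le_antisymm
      (hmono a b hab.subset) (hmono b a hab.symm.subset), ?_, ?_, hident, ?_, ?_, ?_, hcomp⟩,
    fun p => ⟦p⟧, fun p q => rfl⟩
  · exact hext _ _ fun p q => by simpa [hmem] using (h p q q).bot_notMem
  · exact hext _ _ fun p q => by simpa [hmem] using (h p q q).top_mem
  · exact fun a b => hext _ _ fun p q => by simpa [hmem] using (h p q q).sup_mem_iff a b
  · exact fun a => hext _ _ fun p q => by simpa [hmem] using (h p q q).compl_mem_iff a
  · exact fun a => hext _ _ fun p q => by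
      simpa [hmem] using (h p q p).conv_mem_iff (hrefl p) a

end Consistency

/-! ### Guessed labellings of networks -/

section Labelling

variable (A : Type u)

/-- Names for three points for each triple `(a, b, c)` of elements of the algebra; if
`¬ a ; b ≤ c`, these points are to witness this. -/
abbrev Witness : Type u := A × A × A × Fin 3

/-- A labelling of the pairs of points among `k` nodes of a network and all witnesses by sets of
elements of the algebra. -/
abbrev Labelling (k : ℕ) : Type u := (Fin k ⊕ Witness A) → (Fin k ⊕ Witness A) → Set A

variable {A}

/-- The labelling of nodes `0, …, k - 1` that is induced by the map `f` to the nodes of `T`. -/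
def Labelling.pullback {k l : ℕ} (f : Fin k → Fin l) (T : Labelling A l) : Labelling A k :=
  fun p q => T (Sum.map f id p) (Sum.map f id q)

/-- The labelling of the nodes `f 0, …, f (k - 1)` and the witnesses `w` in a representation. -/
def Labelling.ofPoints {D : Type u} (φ : A → SetRel D D) (w : Witness A → D) {k : ℕ}
    (f : Fin k → D) : Labelling A k :=
  fun p q => typeOf φ (Sum.elim f w p) (Sum.elim f w q)

theorem Labelling.pullback_ofPoints {D : Type u} (φ : A → SetRel D D) (w : Witness A → D)
    {k l : ℕ} (f : Fin l → D) (g : Fin k → Fin l) :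
    (ofPoints φ w f).pullback g = ofPoints φ w (f ∘ g) := by
  funext p q
  rcases p with p | p <;> rcases q with q | q <;> rfl

variable [NonassocRelAlgebra A]

/-- The points named by `w` stand in the relation `1'` to themselves and witness all failures of
inequalities `a ; b ≤ c`. -/
structure IsWitnessing {X : Type*} (δ : X → X → Set A) (w : Witness A → X) : Prop where
  ident_mem : ∀ i, ident ∈ δ (w i) (w i)
  mem : ∀ a b c, ¬ comp a b ≤ c → a ∈ δ (w (a, b, c, 0)) (w (a, b, c, 1)) ∧
    b ∈ δ (w (a, b, c, 1)) (w (a, b, c, 2)) ∧ c ∉ δ (w (a, b, c, 0)) (w (a, b, c, 2))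

/-- The condition on the labels and the guesses at the pairs `(x, y)`, `(y, z)`, `(x, z)` of nodes:
the label of `(x, y)` holds, and the guesses are parts of a consistent labelling of the three nodes
and the witnesses. The guess for a pair of nodes is a labelling of these two nodes and the
witnesses. -/
def TripleCondition (c₁ c₂ c₃ : A × Labelling A 2) : Prop :=
  c₁.1 ∈ c₁.2 (Sum.inl 0) (Sum.inl 1) ∧ ∃ T : Labelling A 3, Consistent T ∧
    IsWitnessing T Sum.inr ∧ c₁.2 = T.pullback ![0, 1] ∧ c₂.2 = T.pullback ![1, 2] ∧
      c₃.2 = T.pullback ![0, 2]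

/-- In a representation, the points of the network and witnesses for all failures of inequalities
`a ; b ≤ c` provide the guesses. -/
theorem Network.QualitativelySatisfiable.exists_labelling {n : ℕ} (hn : n ≠ 0)
    {lab : Network (Fin n) A} (h : lab.QualitativelySatisfiable) :
    ∃ μ : Fin n → Fin n → Labelling A 2,
      (∀ x, ∃ y, ident ∈ μ x y (Sum.inl 0) (Sum.inl 1)) ∧
      ∀ x y z, TripleCondition (lab x y, μ x y) (lab y z, μ y z) (lab x z, μ x z) := by
  obtain ⟨D, φ, hφ, f, hf⟩ := h
  have hwit : ∀ a b c, ∃ t : Fin 3 → D, ¬ comp a b ≤ c →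
      a ∈ typeOf φ (t 0) (t 1) ∧ b ∈ typeOf φ (t 1) (t 2) ∧ c ∉ typeOf φ (t 0) (t 2) := by
    intro a b c
    by_cases habc : comp a b ≤ c
    · exact ⟨fun _ => f ⟨0, Nat.pos_of_ne_zero hn⟩, fun hnot => absurd habc hnot⟩
    · rw [← hφ.comp_subset_iff, Set.not_subset] at habc
      obtain ⟨⟨p, r⟩, ⟨q, hpq, hqr⟩, hpr⟩ := habc
      exact ⟨![p, q, r], fun _ => ⟨hpq, hqr, hpr⟩⟩
  choose t ht using hwit
  let w : Witness A → D := fun i => t i.1 i.2.1 i.2.2.1 i.2.2.2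
  have hid : ∀ p, ident ∈ typeOf φ p p := fun p => by simp [typeOf, hφ.map_ident]
  refine ⟨fun x y => Labelling.ofPoints φ w ![f x, f y], fun x => ⟨x, hid _⟩, fun x y z =>
    ⟨hf x y, Labelling.ofPoints φ w ![f x, f y, f z], fun p q r => hφ.consistent _ _ _,
      ⟨fun i => hid _, ht⟩, ?_, ?_, ?_⟩⟩
  all_goals
    rw [Labelling.pullback_ofPoints]
    refine congrArg (Labelling.ofPoints φ w) (funext fun i => ?_)
    fin_cases i <;> rfl

/-- Guesses that satisfy the conditions on triples fit together to a labelling of all nodes and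
witnesses. -/
theorem Network.qualitativelySatisfiable_of_labelling {n : ℕ} (hn : n ≠ 0)
    {lab : Network (Fin n) A} (μ : Fin n → Fin n → Labelling A 2)
    (hrow : ∀ x, ∃ y, ident ∈ μ x y (Sum.inl 0) (Sum.inl 1))
    (hμ : ∀ x y z, TripleCondition (lab x y, μ x y) (lab y z, μ y z) (lab x z, μ x z)) :
    lab.QualitativelySatisfiable := by
  let o : Fin n := ⟨0, Nat.pos_of_ne_zero hn⟩
  let δ : Labelling A n := fun p q => match p, q with
    | Sum.inl x, Sum.inl y => μ x y (Sum.inl 0) (Sum.inl 1)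
    | Sum.inl x, Sum.inr i => μ x x (Sum.inl 0) (Sum.inr i)
    | Sum.inr i, Sum.inl x => μ x x (Sum.inr i) (Sum.inl 0)
    | Sum.inr i, Sum.inr j => μ o o (Sum.inr i) (Sum.inr j)
  -- Guesses for two pairs with a common node, or with none, agree on the points that they share,
  -- since some triple of nodes involves both pairs or links them.
  have hfst : ∀ x y i, μ x y (Sum.inl 0) (Sum.inr i) = μ x x (Sum.inl 0) (Sum.inr i) ∧
      μ x y (Sum.inr i) (Sum.inl 0) = μ x x (Sum.inr i) (Sum.inl 0) := by
    intro x y i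
    obtain ⟨-, T, -, -, h₁, -, h₃⟩ := hμ x x y
    dsimp only at h₁ h₃
    rw [h₁, h₃]
    exact ⟨rfl, rfl⟩
  have hsnd : ∀ x y i, μ x y (Sum.inl 1) (Sum.inr i) = μ y y (Sum.inl 0) (Sum.inr i) ∧
      μ x y (Sum.inr i) (Sum.inl 1) = μ y y (Sum.inr i) (Sum.inl 0) := by
    intro x y i
    obtain ⟨-, T, -, -, h₁, h₂, -⟩ := hμ x y y
    dsimp only at h₁ h₂
    rw [h₁, h₂]
    exact ⟨rfl, rfl⟩
  have hwit : ∀ x y i j, μ x y (Sum.inr i) (Sum.inr j) = μ o o (Sum.inr i) (Sum.inr j) := by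
    intro x y i j
    have h : ∀ x y z, μ x y (Sum.inr i) (Sum.inr j) = μ y z (Sum.inr i) (Sum.inr j) := by
      intro x y z
      obtain ⟨-, T, -, -, h₁, h₂, -⟩ := hμ x y z
      dsimp only at h₁ h₂
      rw [h₁, h₂]
      rfl
    rw [h o o x, h o x y]
  have key : ∀ x y z, ∃ T : Labelling A 3, Consistent T ∧ IsWitnessing T Sum.inr ∧
      (T (Sum.inl 0) (Sum.inl 1) = δ (Sum.inl x) (Sum.inl y) ∧
        T (Sum.inl 1) (Sum.inl 2) = δ (Sum.inl y) (Sum.inl z) ∧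
        T (Sum.inl 0) (Sum.inl 2) = δ (Sum.inl x) (Sum.inl z)) ∧
      (∀ k i, T (Sum.inl k) (Sum.inr i) = δ (Sum.inl (![x, y, z] k)) (Sum.inr i) ∧
        T (Sum.inr i) (Sum.inl k) = δ (Sum.inr i) (Sum.inl (![x, y, z] k))) ∧
      ∀ i j, T (Sum.inr i) (Sum.inr j) = δ (Sum.inr i) (Sum.inr j) := by
    intro x y z
    obtain ⟨-, T, hT, hw, h₁, h₂, h₃⟩ := hμ x y z
    dsimp only at h₁ h₂ h₃
    refine ⟨T, hT, hw, ⟨?_, ?_, ?_⟩, fun k i => ?_, fun i j => ?_⟩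
    · simp only [δ, h₁]
      rfl
    · simp only [δ, h₂]
      rfl
    · simp only [δ, h₃]
      rfl
    · fin_cases k
      · have h := hfst x y i
        rw [h₁] at h
        exact h
      · have h := hsnd x y i
        rw [h₁] at h
        exact h
      · have h := hsnd y z i
        rw [h₂] at h
        exact h
    · have h := hwit x y i j
      rw [h₁] at h
      exact h
  have hδ : Consistent δ := by
    rintro (x | i) (y | j) (z | k)
    · obtain ⟨T, hT, -, ⟨h₁, h₂, h₃⟩, -, -⟩ := key x y z
      rw [← h₁, ← h₂, ← h₃]
      exact hT _ _ _
    · obtain ⟨T, hT, -, ⟨h₁, -, -⟩, h, -⟩ := key x y y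
      have := hT (Sum.inl 0) (Sum.inl 1) (Sum.inr k)
      rwa [h₁, (h 1 k).1, (h 0 k).1] at this
    · obtain ⟨T, hT, -, ⟨h₁, -, -⟩, h, -⟩ := key x z z
      have := hT (Sum.inl 0) (Sum.inr j) (Sum.inl 1)
      rwa [h₁, (h 1 j).2, (h 0 j).1] at this
    · obtain ⟨T, hT, -, -, h, h'⟩ := key x x x
      have := hT (Sum.inl 0) (Sum.inr j) (Sum.inr k)
      rwa [(h 0 j).1, (h 0 k).1, h'] at this
    · obtain ⟨T, hT, -, ⟨h₁, -, -⟩, h, -⟩ := key y z z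
      have := hT (Sum.inr i) (Sum.inl 0) (Sum.inl 1)
      rwa [h₁, (h 1 i).2, (h 0 i).2] at this
    · obtain ⟨T, hT, -, -, h, h'⟩ := key y y y
      have := hT (Sum.inr i) (Sum.inl 0) (Sum.inr k)
      rwa [(h 0 i).2, (h 0 k).1, h'] at this
    · obtain ⟨T, hT, -, -, h, h'⟩ := key z z z
      have := hT (Sum.inr i) (Sum.inr j) (Sum.inl 0)
      rwa [(h 0 i).2, (h 0 j).2, h'] at this
    · obtain ⟨T, hT, -, -, -, h'⟩ := key o o o
      have := hT (Sum.inr i) (Sum.inr j) (Sum.inr k)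
      rwa [h', h', h'] at this
  obtain ⟨T, -, hw, -, -, hTw⟩ := key o o o
  have hrefl : ∀ p, ident ∈ δ p p := by
    rintro (x | i)
    · obtain ⟨y, hy⟩ := hrow x
      exact (hδ (Sum.inl x) (Sum.inl x) (Sum.inl y)).ident_mem hy hy
    · rw [← hTw]
      exact hw.ident_mem i
  obtain ⟨D, φ, hφ, π, hπ⟩ := hδ.exists_isQualitativeRep hrefl fun a b c habc =>
    ⟨Sum.inr (a, b, c, 0), Sum.inr (a, b, c, 1), Sum.inr (a, b, c, 2), by
      simpa only [hTw] using hw.mem a b c habc⟩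
  refine ⟨D, φ, hφ, fun x => π (Sum.inl x), fun x y => ?_⟩
  change lab x y ∈ typeOf φ (π (Sum.inl x)) (π (Sum.inl y))
  rw [hπ]
  exact (hμ x y y).1

end Labelling

theorem mainTheorem6 (A : Type u) [NonassocRelAlgebra A] [Finite A] :
    InNP (networkQualSatProblem A) := by
  refine cast (congrArg (InNP (α := Option A)) (Set.ext fun w => ?_))
    (inNP_exists_triples (A := A) (B := Labelling A 2) ([] ∈ networkQualSatProblem A)
      (fun c => ident ∈ c.2 (Sum.inl 0) (Sum.inl 1)) TripleCondition)
  constructor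
  · rintro ⟨n, lab, rfl, he, μ, hrow, hμ⟩
    rcases eq_or_ne n 0 with rfl | hn
    · exact he rfl
    · exact ⟨n, lab, Network.qualitativelySatisfiable_of_labelling hn μ hrow hμ, rfl⟩
  · rintro ⟨n, lab, hlab, rfl⟩
    rcases eq_or_ne n 0 with rfl | hn
    · exact ⟨0, lab, rfl, fun _ => ⟨0, lab, hlab, rfl⟩, fun x => x.elim0, fun x => x.elim0,
        fun x => x.elim0⟩
    · obtain ⟨μ, hrow, hμ⟩ := hlab.exists_labelling hn
      exact ⟨n, lab, rfl, fun h => absurd h hn, μ, hrow, hμ⟩
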